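/- Consider a torus of $L_x\times L_y$ cells $\vec r=(x,y)$, $x\in\{1,\dots,L_x\}$, $y\in\{1,\dots,L_y\}$ (periodic boundary conditions), with $N$ orbitals $|\vec r,\alpha\rangle$ per cell, and a Hermitian single-particle (tight-binding) Hamiltonian $H$ on $\mathbb C^{L_xL_yN}$; no translation invariance is assumed. Let $n$ be the number of distinct eigenvalues of $H$, and let $R$ be its maximum hopping range, i.e. the smallest $R\ge 0$ such that $\langle\vec r,\alpha|H|\vec r\,',\beta\rangle=0$ for all $\alpha,\beta$ whenever the (Euclidean, periodic) distance of $\vec r$ and $\vec r\,'$ on the torus exceeds $R$. Let $\Phi_0>0$ be the flux quantum. For $(\phi_x,\phi_y)\in\mathbb R^2$ let $H(\phi_x,\phi_y)$ be $H$ with twisted boundary conditions: every matrix element for hopping from a cell with $x$-coordinate in $\{L_x-\lfloor R\rfloor+1,\dots,L_x\}$ to a cell with $x$-coordinate in $\{1,\dots,\lfloor R\rfloor\}$ is multiplied by $e^{-2\pi i\phi_x/\Phi_0}$, those for the reverse hops by $e^{2\pi i\phi_x/\Phi_0}$, and likewise in the $y$-direction with $\phi_y$ and $L_y$. For an eigenvalue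 $E$ of $H$ of multiplicity $k$, let $|\Psi(\phi_x,\phi_y)\rangle$ be the normalized $k$-fermion state, unique up to a phase, in which the eigenspace of $H(\phi_x,\phi_y)$ at $E$ is completely filled, i.e. the Slater determinant of an orthonormal basis of that eigenspace. The many-body (Niu–Thouless–Wu) Chern number of $E$ is $$C=\frac1{2\pi}\int_0^{\Phi_0}\!\!\int_0^{\Phi_0} d\phi_x\,d\phi_y\ \nabla_\phi\times i\langle\Psi|\nabla_\phi\Psi\rangle ,$$ where the integrand, the Berry curvature, is computed at each point in any smooth local choice of the phase of $\Psi$. **Theorem.** If $L_x\ge 3nR$ and $L_y\ge 3nR$, then for every eigenvalue $E$ of $H$ the Chern number is well defined (for all fluxes $E$ is still an eigenvalue of $H(\phi_x,\phi_y)$ of the same multiplicity $k$, smooth local choices of $\Psi$ exist near every point, the Berry curvature does not depend on the choice, and it is integrable), and $C=0$. (Strict locality of $H$, $2R+2\le L_x,L_y$, need not be assumed: the size condition implies it unless $R=0$.) -/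

import Mathlib

open scoped ContDiff

namespace FlatHamiltonian

noncomputable section

/-- Orbitals `|(x, y), α⟩` of a tight-binding model on a torus of `Lx × Ly` cells with `N` orbitals
per cell. The cell coordinate `x : Fin Lx` stands for the `(x + 1)`-st column, `x + 1 ∈ {1, …, Lx}`;
likewise for `y`. -/
abbrev Orbital (Lx Ly N : ℕ) : Type := (Fin Lx × Fin Ly) × Fin N

/-- Distance on a ring of `L` sites. -/
def ringDist {L : ℕ} (i j : Fin L) : ℕ :=
  min ((i : ℤ) - (j : ℤ)).natAbs (L - ((i : ℤ) - (j : ℤ)).natAbs)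

/-- Euclidean distance of two cells on the flat discrete torus. -/
def torusDist {Lx Ly : ℕ} (r s : Fin Lx × Fin Ly) : ℝ :=
  Real.sqrt ((ringDist r.1 s.1 : ℝ) ^ 2 + (ringDist r.2 s.2 : ℝ) ^ 2)

/-- The numbers `ρ ≥ 0` such that `A` has no matrix element between cells at distance `> ρ`. -/
def rangeBounds {Lx Ly N : ℕ} (A : Matrix (Orbital Lx Ly N) (Orbital Lx Ly N) ℂ) : Set ℝ :=
  {ρ | 0 ≤ ρ ∧ ∀ (r s : Fin Lx × Fin Ly) (α β : Fin N), ρ < torusDist r s → A (r, α) (s, β) = 0}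

/-- The maximum hopping range: the smallest `ρ ≥ 0` such that `A` has no matrix element between
cells at distance `> ρ`. -/
def hoppingRange {Lx Ly N : ℕ} (A : Matrix (Orbital Lx Ly N) (Orbital Lx Ly N) ℂ) : ℝ :=
  sInf (rangeBounds A)

/-- The infimum in the definition of the hopping range is attained. -/
theorem isLeast_hoppingRange {Lx Ly N : ℕ} (A : Matrix (Orbital Lx Ly N) (Orbital Lx Ly N) ℂ) :
    IsLeast (rangeBounds A) (hoppingRange A) := by
  have hbdd : BddBelow (rangeBounds A) := ⟨0, fun ρ h => h.1⟩
  have hne : (rangeBounds A).Nonempty := by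
    refine ⟨∑ r : Fin Lx × Fin Ly, ∑ s : Fin Lx × Fin Ly, torusDist r s,
      Finset.sum_nonneg fun r _ => Finset.sum_nonneg fun s _ => Real.sqrt_nonneg _, ?_⟩
    intro r s α β h
    exfalso
    refine absurd h (not_lt.mpr ?_)
    calc torusDist r s ≤ ∑ s : Fin Lx × Fin Ly, torusDist r s :=
          Finset.single_le_sum (f := fun s => torusDist r s)
            (fun s _ => Real.sqrt_nonneg _) (Finset.mem_univ s)
      _ ≤ _ := Finset.single_le_sum (f := fun r => ∑ s : Fin Lx × Fin Ly, torusDist r s)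
            (fun r _ => Finset.sum_nonneg fun s _ => Real.sqrt_nonneg _) (Finset.mem_univ r)
  have hcl : IsClosed (rangeBounds A) := by
    have h : rangeBounds A = Set.Ici 0 ∩ ⋂ (r : Fin Lx × Fin Ly) (s : Fin Lx × Fin Ly)
        (α : Fin N) (β : Fin N) (_ : A (r, α) (s, β) ≠ 0), Set.Ici (torusDist r s) := by
      ext ρ
      simp only [rangeBounds, Set.mem_ofPred_eq, Set.mem_inter_iff, Set.mem_Ici, Set.mem_iInter]
      refine and_congr_right fun _ => ⟨fun h r s α β hA => ?_, fun h r s α β hd => ?_⟩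
      · by_contra hlt
        exact hA (h r s α β (not_le.mp hlt))
      · by_contra hA
        exact absurd hd (not_lt.mpr (h r s α β hA))
    rw [h]
    refine isClosed_Ici.inter ?_
    refine isClosed_iInter fun r => isClosed_iInter fun s => isClosed_iInter fun α =>
      isClosed_iInter fun β => isClosed_iInter fun _ => isClosed_Ici
  exact ⟨hcl.csInf_mem hne hbdd, fun ρ h => csInf_le hbdd h⟩

/-- Twisted boundary condition with angle `θ` on a ring of `L` sites, for hoppings of range at most
`R`: the factor of the matrix element `⟨i| · |j⟩`, which describes hopping from `j` to `i`.
In the coordinates `i + 1, j + 1 ∈ {1, …, L}`, a hop from one of the last `⌊R⌋` sites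
`{L - ⌊R⌋ + 1, …, L}` to one of the first `⌊R⌋` sites `{1, …, ⌊R⌋}` gets `e^{-iθ}`, a hop in the
reverse direction gets `e^{iθ}`, and all other hops are unchanged. -/
def twistPhase (L : ℕ) (R θ : ℝ) (i j : Fin L) : ℂ :=
  if (i : ℝ) + 1 ≤ R ∧ (L : ℝ) ≤ (j : ℝ) + R then Complex.exp (-(Complex.I * θ))
  else if (j : ℝ) + 1 ≤ R ∧ (L : ℝ) ≤ (i : ℝ) + R then Complex.exp (Complex.I * θ)
  else 1

/-- `H(φx, φy)`: Peierls substitution for fluxes `φ = (φx, φy)` through the two holes of the torus,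
in the gauge of twisted boundary conditions; `Φ₀` is the flux quantum. -/
def twisted {Lx Ly N : ℕ} (Φ₀ : ℝ) (H : Matrix (Orbital Lx Ly N) (Orbital Lx Ly N) ℂ)
    (φ : ℝ × ℝ) : Matrix (Orbital Lx Ly N) (Orbital Lx Ly N) ℂ :=
  Matrix.of fun a b =>
    twistPhase Lx (hoppingRange H) (2 * Real.pi * φ.1 / Φ₀) a.1.1 b.1.1 *
      twistPhase Ly (hoppingRange H) (2 * Real.pi * φ.2 / Φ₀) a.1.2 b.1.2 * H a b

/-- The one-particle eigenspace of `A` at energy `E`. -/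
def energySpace {ι : Type*} [Fintype ι] [DecidableEq ι] (A : Matrix ι ι ℂ) (E : ℝ) :
    Submodule ℂ (EuclideanSpace ℂ ι) :=
  Module.End.eigenspace (Matrix.toEuclideanLin A) (E : ℂ)

/-- The Slater determinant of `k` one-particle wavefunctions, as a `k`-particle wavefunction:
`Ψ(s₁, …, s_k) = (k!)^{-1/2} det (w_b(s_a))`. -/
def slater {ι : Type*} [Fintype ι] {k : ℕ} (w : Fin k → EuclideanSpace ℂ ι) :
    EuclideanSpace ℂ (Fin k → ι) :=
  WithLp.toLp 2 fun s =>
    ((Real.sqrt (k.factorial : ℝ))⁻¹ : ℂ) * (Matrix.of fun a b : Fin k => w b (s a)).det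

/-- The normalized `k`-fermion wavefunctions of the state in which the energy level `E` of `A` is
completely filled and everything else is empty, i.e. the Slater determinants of the orthonormal
bases of the eigenspace. There are none unless that eigenspace has dimension `k`. -/
def filledStates {ι : Type*} [Fintype ι] [DecidableEq ι] (A : Matrix ι ι ℂ) (E : ℝ) (k : ℕ) :
    Set (EuclideanSpace ℂ (Fin k → ι)) :=
  {Ψ | ∃ w : Fin k → EuclideanSpace ℂ ι, Orthonormal ℂ w ∧
    Submodule.span ℂ (Set.range w) = energySpace A E ∧ Ψ = slater w}

section Berry

variable {V : Type*} [NormedAddCommGroup V] [InnerProductSpace ℂ V] [NormedSpace ℝ V]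

/-- Component of the Berry connection `i ⟨Ψ|∇Ψ⟩` in the direction `e`. -/
def berryConnection (Ψ : ℝ × ℝ → V) (e φ : ℝ × ℝ) : ℂ :=
  Complex.I * inner ℂ (Ψ φ) (fderiv ℝ Ψ φ e)

/-- The curl `∂ₓ A_y - ∂_y Aₓ` of the Berry connection `A = i ⟨Ψ|∇Ψ⟩`. -/
def berryCurl (Ψ : ℝ × ℝ → V) (φ : ℝ × ℝ) : ℂ :=
  fderiv ℝ (berryConnection Ψ (0, 1)) φ (1, 0) - fderiv ℝ (berryConnection Ψ (1, 0)) φ (0, 1)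

/-- A smooth local gauge on `U` for a family of (rays of) states: a smooth choice `Ψ φ ∈ S φ`. -/
structure IsGauge (S : ℝ × ℝ → Set V) (U : Set (ℝ × ℝ)) (Ψ : ℝ × ℝ → V) : Prop where
  isOpen : IsOpen U
  smooth : ContDiffOn ℝ ∞ Ψ U
  mem : ∀ φ ∈ U, Ψ φ ∈ S φ

/-- `F` is the Berry curvature of the family `S`: around each point there is a smooth local gauge,
and in every smooth local gauge `F` is the curl of the Berry connection. -/
def IsBerryCurvature (S : ℝ × ℝ → Set V) (F : ℝ × ℝ → ℂ) : Prop :=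
  ∀ φ, (∃ U Ψ, φ ∈ U ∧ IsGauge S U Ψ) ∧ ∀ U Ψ, φ ∈ U → IsGauge S U Ψ → F φ = berryCurl Ψ φ

/-- The family `S` of states over the flux torus has a well-defined Chern number
`C = (1/2π) ∫₀^{Φ₀} ∫₀^{Φ₀} (∇ × i⟨Ψ|∇Ψ⟩) dφx dφy`. -/
def HasChernNumber (Φ₀ : ℝ) (S : ℝ × ℝ → Set V) (C : ℂ) : Prop :=
  ∃ F : ℝ × ℝ → ℂ, IsBerryCurvature S F ∧
    MeasureTheory.IntegrableOn F (Set.Icc 0 Φ₀ ×ˢ Set.Icc 0 Φ₀) ∧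
    C = (1 / (2 * Real.pi) : ℂ) * ∫ φ in Set.Icc 0 Φ₀ ×ˢ Set.Icc 0 Φ₀, F φ

/-- A family of states has at most one Chern number. -/
theorem HasChernNumber.unique {Φ₀ : ℝ} {S : ℝ × ℝ → Set V} {C C' : ℂ}
    (h : HasChernNumber Φ₀ S C) (h' : HasChernNumber Φ₀ S C') : C = C' := by
  obtain ⟨F, hF, _, rfl⟩ := h
  obtain ⟨F', hF', _, rfl⟩ := h'
  have : F = F' := by
    funext φ
    obtain ⟨U, Ψ, hU, hΨ⟩ := (hF φ).1
    rw [(hF φ).2 U Ψ hU hΨ, (hF' φ).2 U Ψ hU hΨ]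
  rw [this]

end Berry

/-- The Niu–Thouless–Wu (twist-angle) Chern number associated with the energy `E` of `H` exists and
equals `C`: it is the Chern number of the many-body states of `H(φx, φy)` in which the level `E`,
whose number of particles is its degeneracy at zero flux, is fully filled. -/
def HasManyBodyChernNumber {Lx Ly N : ℕ} (Φ₀ : ℝ)
    (H : Matrix (Orbital Lx Ly N) (Orbital Lx Ly N) ℂ) (E : ℝ) (C : ℂ) : Prop :=
  HasChernNumber Φ₀
    (fun φ => filledStates (twisted Φ₀ H φ) E (Module.finrank ℂ (energySpace H E))) C

end

end FlatHamiltonian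

/-!
The proof works with formal twist factors `z`, `w` in place of `exp (2πi φ_x / Φ₀)`,
`exp (2πi φ_y / Φ₀)`: the twisted Hamiltonian becomes a matrix of Laurent polynomials (`twist`), and
real fluxes are recovered by evaluation (`fluxEval`).

A product of at most `n` hops of range `R` is too short to wind around the torus, so twisting
commutes with polynomials in `H` of degree at most `n` (`twist_aeval`). Applied to the minimal
polynomial and to the Lagrange polynomial of a level `E`, this shows that the level persists for all
fluxes and that its projector is an idempotent matrix `P` of Laurent polynomials in `z`, `w` with
constant trace `k` (`exists_twisted_projector`).

The `k`-particle projector `|Ψ⟩⟨Ψ|` of the filled level has entries `det (P (s_a, t_b)) / k!`, so it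
is a matrix `Q` of Laurent polynomials as well (`slaterProj`, `IsLevelPoly.slaterProj_eq`). In every
smooth gauge the Berry curvature is `i tr Q [∂_x Q, ∂_y Q]` (`berryCurl_eq_fluxEval`), a Laurent
polynomial, and its integral over the flux torus picks out the constant term
(`setIntegral_fluxEval`).

That constant term vanishes for an algebraic reason (`coeff_zero_fluxCurvature_slaterProj`). Laurent
polynomials embed into the field of iterated formal Laurent series, and over a field the image of
the idempotent `P` has a basis: `P = B B'` with `B' B = 1`. By the Cauchy–Binet formula, `Q = ψ χᵀ` with
`χ ⬝ ψ = 1`, which is a global gauge over that field. In it, the curvature is the curl of the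
connection `χ ⬝ Dψ`, and a logarithmic derivative has no constant term.
-/

namespace FlatHamiltonian

noncomputable section

/-! ### Projectors onto Slater determinants -/

/-- **Cauchy–Binet formula**, summed over all maps `s : Fin k → ι` instead of over subsets of `ι`,
which is why every minor occurs `k!` times. -/
theorem sum_det_mul_det {R ι : Type*} [CommRing R] [Fintype ι] {k : ℕ}
    (X : Matrix (Fin k) ι R) (Y : Matrix ι (Fin k) R) :
    ∑ s : Fin k → ι, (Matrix.of fun a b => X a (s b)).det * (Matrix.of fun a b => Y (s a) b).det
      = (k.factorial : R) * (X * Y).det := by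
  classical
  -- Summing over `s` turns the Leibniz expansion of the first minor into that of `det (X * Y)` with
  -- permuted columns.
  have key : ∀ σ : Equiv.Perm (Fin k),
      ∑ s : Fin k → ι, (Matrix.of fun a b => X a (s b)).det * ∏ a, Y (s (σ a)) a
        = (Equiv.Perm.sign σ : ℤ) * (X * Y).det := by
    intro σ
    calc _ = ∑ s : Fin k → ι, ∑ τ : Equiv.Perm (Fin k),
          ((Equiv.Perm.sign τ : ℤ) : R) * ∏ a, X (τ (σ a)) (s (σ a)) * Y (s (σ a)) a := by
          refine Finset.sum_congr rfl fun s _ => ?_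
          rw [Matrix.det_apply', Finset.sum_mul]
          refine Finset.sum_congr rfl fun τ _ => ?_
          rw [mul_assoc, Finset.prod_mul_distrib]
          congr 2
          exact (Equiv.prod_comp σ fun b => X (τ b) (s b)).symm
      _ = ∑ τ : Equiv.Perm (Fin k), ((Equiv.Perm.sign τ : ℤ) : R) *
            ∏ a, (X * Y) (τ (σ a)) a := by
          rw [Finset.sum_comm]
          refine Finset.sum_congr rfl fun τ _ => ?_
          rw [← Finset.mul_sum]
          congr 1
          simp only [Matrix.mul_apply]
          rw [Finset.prod_univ_sum, Fintype.piFinset_univ]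
          exact Equiv.sum_comp (σ.symm.arrowCongr (Equiv.refl ι))
            (fun s : Fin k → ι => ∏ a, X (τ (σ a)) (s a) * Y (s a) a)
      _ = _ := by
          rw [Matrix.det_apply', Finset.mul_sum,
            ← Equiv.sum_comp (Equiv.mulRight σ)
              (fun τ => ((Equiv.Perm.sign σ : ℤ) : R) * (((Equiv.Perm.sign τ : ℤ) : R) *
                ∏ a, (X * Y) (τ a) a))]
          refine Finset.sum_congr rfl fun τ _ => ?_
          have h : (((Equiv.Perm.sign σ : ℤ) : R)) * ((Equiv.Perm.sign σ : ℤ) : R) = 1 := by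
            rw [← Int.cast_mul, ← Units.val_mul, Int.units_mul_self]; simp
          simp only [Equiv.coe_mulRight, Equiv.Perm.sign_mul, Units.val_mul, Int.cast_mul,
            Equiv.Perm.coe_mul, Function.comp_apply]
          linear_combination (-((Equiv.Perm.sign τ : ℤ) : R) * ∏ a, (X * Y) (τ (σ a)) a) * h
  calc _ = ∑ σ : Equiv.Perm (Fin k), ((Equiv.Perm.sign σ : ℤ) : R) *
        ∑ s : Fin k → ι, (Matrix.of fun a b => X a (s b)).det * ∏ a, Y (s (σ a)) a := by
        simp only [Matrix.det_apply' (Matrix.of fun a b => Y _ b), Finset.mul_sum, Matrix.of_apply]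
        rw [Finset.sum_comm]
        refine Finset.sum_congr rfl fun σ _ => Finset.sum_congr rfl fun s _ => ?_
        ring
    _ = ∑ σ : Equiv.Perm (Fin k), (X * Y).det := by
        refine Finset.sum_congr rfl fun σ _ => ?_
        rw [key, ← mul_assoc, ← Int.cast_mul, ← Units.val_mul, Int.units_mul_self]
        simp
    _ = _ := by
        simp [Fintype.card_perm]

/-- The `k`-particle projector onto the Slater determinant that fills the image of a one-particle
projector `P` of rank `k`, as a polynomial in the entries of `P`. -/
def slaterProj {R ι : Type*} [CommRing R] [Algebra ℂ R] (k : ℕ) (P : Matrix ι ι R) :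
    Matrix (Fin k → ι) (Fin k → ι) R :=
  Matrix.of fun s t => ((k.factorial : ℂ)⁻¹) • (Matrix.of fun a b => P (s a) (t b)).det

theorem slaterProj_map {R S ι : Type*} [CommRing R] [Algebra ℂ R] [CommRing S] [Algebra ℂ S]
    (f : R →ₐ[ℂ] S) (k : ℕ) (P : Matrix ι ι R) :
    (slaterProj k P).map f = slaterProj k (P.map f) := by
  ext s t
  simp only [slaterProj, Matrix.map_apply, Matrix.of_apply, map_smul, AlgHom.map_det]
  rfl

/-- A projector `P = B B'` that factors through a free module of rank `k` has a `k`-particle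
projector of rank one. -/
theorem slaterProj_mul {R ι : Type*} [CommRing R] [Algebra ℂ R] {k : ℕ}
    (B : Matrix ι (Fin k) R) (B' : Matrix (Fin k) ι R) :
    slaterProj k (B * B') = Matrix.vecMulVec
      (fun s : Fin k → ι => (Matrix.of fun a b => B (s a) b).det)
      (fun t : Fin k → ι => ((k.factorial : ℂ)⁻¹) • (Matrix.of fun a b => B' a (t b)).det) := by
  ext s t
  rw [Matrix.vecMulVec_apply, mul_smul_comm, ← Matrix.det_mul]
  simp only [slaterProj, Matrix.of_apply]
  congr 2

theorem dotProduct_slater_minors {R ι : Type*} [CommRing R] [Algebra ℂ R] [Fintype ι] {k : ℕ}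
    {B : Matrix ι (Fin k) R} {B' : Matrix (Fin k) ι R} (h : B' * B = 1) :
    (fun t : Fin k → ι => ((k.factorial : ℂ)⁻¹) • (Matrix.of fun a b => B' a (t b)).det) ⬝ᵥ
      (fun s : Fin k → ι => (Matrix.of fun a b => B (s a) b).det) = 1 := by
  simp only [dotProduct, smul_mul_assoc]
  rw [← Finset.smul_sum, sum_det_mul_det, h, Matrix.det_one, mul_one,
    ← map_natCast (algebraMap ℂ R), Algebra.smul_def, ← map_mul, inv_mul_cancel₀ (by exact_mod_cast k.factorial_ne_zero), map_one]

/-- An idempotent matrix over a field is the product of a basis of its image with the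
corresponding coordinate functionals. -/
theorem exists_factorization_of_idempotent {F ι : Type*} [Field F] [Fintype ι] [DecidableEq ι]
    {P : Matrix ι ι F} (hP : P * P = P) :
    ∃ (r : ℕ) (B : Matrix ι (Fin r) F) (B' : Matrix (Fin r) ι F), B * B' = P ∧ B' * B = 1 := by
  let f := Matrix.toLin' P
  have hf : f ∘ₗ f = f := by rw [← Matrix.toLin'_mul, hP]
  let b := Module.finBasis F (LinearMap.range f)
  refine ⟨_, LinearMap.toMatrix b (Pi.basisFun F ι) (LinearMap.range f).subtype,
    LinearMap.toMatrix (Pi.basisFun F ι) b f.rangeRestrict, ?_, ?_⟩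
  · rw [← LinearMap.toMatrix_comp]
    have : (LinearMap.range f).subtype ∘ₗ f.rangeRestrict = f := by ext; rfl
    rw [this]
    exact LinearMap.toMatrix'_toLin' P
  · rw [← LinearMap.toMatrix_comp]
    have : f.rangeRestrict ∘ₗ (LinearMap.range f).subtype = LinearMap.id := by
      ext ⟨_, x, rfl⟩ : 2
      exact LinearMap.congr_fun hf x
    rw [this, LinearMap.toMatrix_id]

/-- The curvature expression `tr Q [X, Y]` of a projector `Q = ψ χᵀ` of rank one, where `X` and `Y`
are two derivatives of `Q`, `a` and `b` those of `ψ`, and `c` and `d` those of `χ`. -/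
theorem trace_rankOne_commutator {R ι : Type*} [CommRing R] [Fintype ι] {ψ χ a b c d : ι → R}
    (h : χ ⬝ᵥ ψ = 1) (hx : c ⬝ᵥ ψ + χ ⬝ᵥ a = 0) (hy : d ⬝ᵥ ψ + χ ⬝ᵥ b = 0) :
    (Matrix.vecMulVec ψ χ *
      ((Matrix.vecMulVec a χ + Matrix.vecMulVec ψ c) * (Matrix.vecMulVec b χ + Matrix.vecMulVec ψ d)
      - (Matrix.vecMulVec b χ + Matrix.vecMulVec ψ d) *
        (Matrix.vecMulVec a χ + Matrix.vecMulVec ψ c))).trace = c ⬝ᵥ b - d ⬝ᵥ a := by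
  have e : ∀ u : ι → R, ψ ⬝ᵥ u = u ⬝ᵥ ψ := fun u => dotProduct_comm _ _
  simp only [mul_add, add_mul, mul_sub, Matrix.vecMulVec_mul_vecMulVec, Matrix.trace_add,
    Matrix.trace_sub, Matrix.trace_vecMulVec, Matrix.vecMulVec_smul,
    Matrix.trace_smul, smul_eq_mul, Matrix.mul_smul, h, e]
  ring_nf
  linear_combination (d ⬝ᵥ ψ) * hx - (c ⬝ᵥ ψ) * hy

/-! ### Laurent polynomials in the two twist factors -/

/-- Laurent polynomials in the two twist factors `z` and `w`; `single (p, q) c` is `c z^p w^q`. -/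
abbrev FluxRing : Type := AddMonoidAlgebra ℂ (ℤ × ℤ)

/-- Iterated formal Laurent series in `z` and `w`: a field that contains the Laurent polynomials. -/
abbrev FluxField : Type := HahnSeries (ℤ ×ₗ ℤ) ℂ

/-- The logarithmic derivative `z^p w^q ↦ c(p, q) z^p w^q` on Laurent polynomials, for an additive
function `c` of the exponents. -/
def FluxRing.deriv (c : ℤ × ℤ →+ ℂ) (f : FluxRing) : FluxRing :=
  .ofCoeff (Finsupp.onFinset f.coeff.support (fun g => c g * f.coeff g) fun g hg => by
    simpa using right_ne_zero_of_mul hg)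

theorem FluxRing.coeff_deriv (c : ℤ × ℤ →+ ℂ) (f : FluxRing) (g : ℤ × ℤ) :
    (f.deriv c).coeff g = c g * f.coeff g := rfl

theorem FluxRing.deriv_single (c : ℤ × ℤ →+ ℂ) (g : ℤ × ℤ) (r : ℂ) :
    FluxRing.deriv c (.single g r) = .single g (c g * r) := by
  ext h
  rw [coeff_deriv]
  by_cases hg : g = h
  · subst hg; simp
  · simp [Finsupp.single_eq_of_ne' hg]

theorem FluxRing.deriv_add (c : ℤ × ℤ →+ ℂ) (f g : FluxRing) :
    (f + g).deriv c = f.deriv c + g.deriv c := by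
  ext h
  simp [coeff_deriv, mul_add]

theorem FluxRing.deriv_zero (c : ℤ × ℤ →+ ℂ) : (0 : FluxRing).deriv c = 0 := by
  ext h
  simp [coeff_deriv]

/-- The logarithmic derivative `z^p w^q ↦ c(p, q) z^p w^q` on iterated Laurent series. -/
def FluxField.deriv (c : ℤ × ℤ →+ ℂ) (f : FluxField) : FluxField where
  coeff g := c (ofLex g) * f.coeff g
  isPWO_support' := f.isPWO_support.mono fun _ hg => right_ne_zero_of_mul hg

theorem FluxField.coeff_deriv (c : ℤ × ℤ →+ ℂ) (f : FluxField) (g : ℤ ×ₗ ℤ) :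
    (f.deriv c).coeff g = c (ofLex g) * f.coeff g := rfl

theorem FluxField.support_deriv_subset (c : ℤ × ℤ →+ ℂ) (f : FluxField) :
    (f.deriv c).support ⊆ f.support :=
  fun _ hg => right_ne_zero_of_mul hg

theorem FluxField.deriv_add (c : ℤ × ℤ →+ ℂ) (f g : FluxField) :
    (f + g).deriv c = f.deriv c + g.deriv c := by
  ext h
  simp [coeff_deriv, mul_add]

theorem FluxField.deriv_zero (c : ℤ × ℤ →+ ℂ) : (0 : FluxField).deriv c = 0 := by
  ext h
  simp [coeff_deriv]

theorem FluxField.deriv_mul (c : ℤ × ℤ →+ ℂ) (f g : FluxField) :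
    (f * g).deriv c = f.deriv c * g + f * g.deriv c := by
  ext h
  rw [coeff_deriv, HahnSeries.coeff_add', Pi.add_apply, HahnSeries.coeff_mul,
    HahnSeries.coeff_mul_left' f.isPWO_support (support_deriv_subset c f),
    HahnSeries.coeff_mul_right' g.isPWO_support (support_deriv_subset c g),
    ← Finset.sum_add_distrib, Finset.mul_sum]
  refine Finset.sum_congr rfl fun p hp => ?_
  have hp' : p.1 + p.2 = h := by
    have := hp
    rw [Finset.mem_antidiagonal] at this
    exact this.2.2
  rw [coeff_deriv, coeff_deriv, ← hp', ofLex_add, map_add]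
  ring

theorem FluxField.deriv_comm (c d : ℤ × ℤ →+ ℂ) (f : FluxField) :
    (f.deriv c).deriv d = (f.deriv d).deriv c := by
  ext h
  simp only [coeff_deriv]
  ring

theorem FluxField.deriv_sum {κ : Type*} (c : ℤ × ℤ →+ ℂ) (s : Finset κ) (f : κ → FluxField) :
    (∑ i ∈ s, f i).deriv c = ∑ i ∈ s, (f i).deriv c :=
  map_sum (⟨⟨FluxField.deriv c, deriv_zero c⟩, deriv_add c⟩ : FluxField →+ FluxField) f s

/-- The logarithmic derivative of a series has no constant term. -/
theorem FluxField.coeff_zero_deriv (c : ℤ × ℤ →+ ℂ) (f : FluxField) : (f.deriv c).coeff 0 = 0 := by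
  have : c (ofLex 0) = 0 := map_zero c
  rw [coeff_deriv, this, zero_mul]

theorem FluxField.deriv_one (c : ℤ × ℤ →+ ℂ) : (1 : FluxField).deriv c = 0 := by
  have h := deriv_mul c 1 1
  simpa using h

/-- The embedding of Laurent polynomials into iterated Laurent series. -/
def FluxRing.toField : FluxRing →ₐ[ℂ] FluxField :=
  AddMonoidAlgebra.lift ℂ FluxField (ℤ × ℤ)
    { toFun := fun g => HahnSeries.single (toLex g.toAdd) 1
      map_one' := rfl
      map_mul' := fun g h => by simp [HahnSeries.single_mul_single] }

theorem FluxRing.toField_single (g : ℤ × ℤ) (r : ℂ) :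
    toField (.single g r) = HahnSeries.single (toLex g) r := by
  rw [toField, AddMonoidAlgebra.lift_single]
  change r • HahnSeries.single (toLex g) (1 : ℂ) = _
  ext h
  simp [HahnSeries.coeff_single]

theorem FluxRing.coeff_toField (f : FluxRing) (g : ℤ × ℤ) :
    (toField f).coeff (toLex g) = f.coeff g := by
  induction f using AddMonoidAlgebra.induction_linear with
  | zero => simp
  | add f h hf hh => simp [hf, hh]
  | single p r =>
    rw [toField_single]
    by_cases hg : g = p
    · subst hg; simp
    · rw [HahnSeries.coeff_single_of_ne (fun h => hg (toLex.injective h))]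
      simp [Finsupp.single_eq_of_ne hg]

theorem FluxRing.toField_deriv (c : ℤ × ℤ →+ ℂ) (f : FluxRing) :
    toField (f.deriv c) = (toField f).deriv c := by
  ext g
  rw [FluxField.coeff_deriv, ← toLex_ofLex g, coeff_toField, coeff_toField, coeff_deriv]
  rfl

/-- The curvature `tr Q [D_c Q, D_d Q]` of a matrix of Laurent polynomials for the logarithmic
derivatives `D_c` and `D_d`. -/
def fluxCurvature {κ : Type*} [Fintype κ] (c d : ℤ × ℤ →+ ℂ) (Q : Matrix κ κ FluxRing) : FluxRing :=
  (Q * (Q.map (FluxRing.deriv c) * Q.map (FluxRing.deriv d)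
    - Q.map (FluxRing.deriv d) * Q.map (FluxRing.deriv c))).trace

theorem FluxField.deriv_dotProduct {κ : Type*} [Fintype κ] (c : ℤ × ℤ →+ ℂ) (u v : κ → FluxField) :
    (u ⬝ᵥ v).deriv c = (fun i => (u i).deriv c) ⬝ᵥ v + u ⬝ᵥ fun i => (v i).deriv c := by
  simp only [dotProduct, deriv_sum, deriv_mul, Finset.sum_add_distrib]

/-- The curvature of the `k`-particle projector of an idempotent matrix `P` of Laurent polynomials
has no constant term: over the field of iterated Laurent series the image of `P` has a basis, and in
the resulting gauge the curvature is the curl of a connection. -/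
theorem coeff_zero_fluxCurvature_slaterProj {ι : Type*} [Fintype ι] [DecidableEq ι]
    (c d : ℤ × ℤ →+ ℂ) {k : ℕ} {P : Matrix ι ι FluxRing} (hP : P * P = P) (htr : P.trace = k) :
    (fluxCurvature c d (slaterProj k P)).coeff 0 = 0 := by
  have hPF : P.map FluxRing.toField * P.map FluxRing.toField = P.map FluxRing.toField := by
    rw [← Matrix.map_mul, hP]
  obtain ⟨r, B, B', hB, hB'⟩ := exists_factorization_of_idempotent hPF
  obtain rfl : r = k := by
    have h : (r : FluxField) = k := by
      calc (r : FluxField) = (B' * B).trace := by simp [hB']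
        _ = (P.map FluxRing.toField).trace := by rw [Matrix.trace_mul_comm, hB]
        _ = FluxRing.toField P.trace := by simp [Matrix.trace]
        _ = k := by rw [htr, map_natCast]
    rw [← map_natCast (algebraMap ℂ FluxField), ← map_natCast (algebraMap ℂ FluxField)] at h
    exact_mod_cast (algebraMap ℂ FluxField).injective h
  set χ : (Fin r → ι) → FluxField :=
    fun t => ((r.factorial : ℂ)⁻¹) • (Matrix.of fun a b => B' a (t b)).det with hχ
  set ψ : (Fin r → ι) → FluxField := fun s => (Matrix.of fun a b => B (s a) b).det with hψ
  have hQ : (slaterProj r P).map FluxRing.toField = Matrix.vecMulVec ψ χ := by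
    rw [slaterProj_map, ← hB, slaterProj_mul]
  have h1 : χ ⬝ᵥ ψ = 1 := dotProduct_slater_minors hB'
  have hd : ∀ e : ℤ × ℤ →+ ℂ,
      (fun t => (χ t).deriv e) ⬝ᵥ ψ + χ ⬝ᵥ (fun s => (ψ s).deriv e) = 0 := fun e => by
    rw [← FluxField.deriv_dotProduct, h1, FluxField.deriv_one]
  have hQd : ∀ e : ℤ × ℤ →+ ℂ, ((slaterProj r P).map (FluxRing.deriv e)).map FluxRing.toField
      = Matrix.vecMulVec (fun s => (ψ s).deriv e) χ
        + Matrix.vecMulVec ψ fun t => (χ t).deriv e := by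
    intro e
    ext1 s t
    have := congrFun (congrFun hQ s) t
    rw [Matrix.map_apply, Matrix.vecMulVec_apply] at this
    rw [Matrix.map_apply, Matrix.map_apply, FluxRing.toField_deriv, this, FluxField.deriv_mul]
    rfl
  have hT : FluxRing.toField (fluxCurvature c d (slaterProj r P))
      = (χ ⬝ᵥ fun s => (ψ s).deriv d).deriv c - (χ ⬝ᵥ fun s => (ψ s).deriv c).deriv d := by
    have : FluxRing.toField (fluxCurvature c d (slaterProj r P))
        = (fun t => (χ t).deriv c) ⬝ᵥ (fun s => (ψ s).deriv d)
          - (fun t => (χ t).deriv d) ⬝ᵥ (fun s => (ψ s).deriv c) := by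
      rw [← trace_rankOne_commutator h1 (hd c) (hd d), ← hQ, ← hQd, ← hQd, fluxCurvature]
      simp only [← Matrix.map_mul]
      rw [← Matrix.map_sub (f := FluxRing.toField) (fun a b => map_sub _ a b), ← Matrix.map_mul]
      simp only [Matrix.trace, Matrix.diag, map_sum, Matrix.map_apply]
    rw [this, FluxField.deriv_dotProduct, FluxField.deriv_dotProduct]
    simp only [FluxField.deriv_comm d c]
    ring
  rw [← FluxRing.coeff_toField, hT]
  change (_ : FluxField).coeff 0 = 0
  rw [HahnSeries.coeff_sub, FluxField.coeff_zero_deriv, FluxField.coeff_zero_deriv, sub_zero]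

/-! ### Winding numbers and the formal twist -/

/-- How often the shortest path from `j` to `i` on a ring of `L` sites crosses the cut between the
last and the first site, counted positively for hops from the first to the last site. -/
def wind (L : ℕ) (i j : Fin L) : ℤ :=
  if (L : ℤ) < 2 * ((i : ℤ) - j) then 1 else if (L : ℤ) < 2 * ((j : ℤ) - i) then -1 else 0

/-- The signed length of the shortest path from `j` to `i` on a ring of `L` sites. -/
def offset (L : ℕ) (i j : Fin L) : ℤ := (i : ℤ) - j - L * wind L i j

theorem wind_self (L : ℕ) (i : Fin L) : wind L i i = 0 := by
  unfold wind
  split_ifs <;> omega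

theorem wind_swap (L : ℕ) (i j : Fin L) : wind L j i = -wind L i j := by
  unfold wind
  split_ifs <;> omega

/-- Only one choice of the winding number makes the displacement shorter than half of the ring. -/
theorem eq_wind {L : ℕ} {i j : Fin L} {m : ℤ} (h : 2 * |(i : ℤ) - j - L * m| < L) :
    m = wind L i j := by
  have hi := i.2
  have hj := j.2
  rw [Int.abs_eq_natAbs] at h
  have h1 : m < 2 := by
    by_contra hm
    have : (L : ℤ) * 2 ≤ L * m := by gcongr; omega
    omega
  have h2 : -2 < m := by
    by_contra hm
    have : (L : ℤ) * m ≤ L * (-2) := by gcongr; omega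
    omega
  unfold wind
  obtain rfl | rfl | rfl : m = -1 ∨ m = 0 ∨ m = 1 := by omega
  all_goals split_ifs <;> omega

theorem abs_offset {L : ℕ} (i j : Fin L) : |offset L i j| = ringDist i j := by
  have hi := i.2
  have hj := j.2
  rw [Int.abs_eq_natAbs]
  unfold offset wind ringDist
  split_ifs <;> omega

/-- Short hops compose without ambiguity: their winding numbers add up. -/
theorem wind_add {L : ℕ} {i l j : Fin L} {ρ σ : ℝ} (h1 : |(offset L i l : ℝ)| ≤ ρ)
    (h2 : |(offset L l j : ℝ)| ≤ σ) (h : 2 * (ρ + σ) < L) :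
    wind L i l + wind L l j = wind L i j ∧ |(offset L i j : ℝ)| ≤ ρ + σ := by
  have e : (i : ℤ) - j - L * (wind L i l + wind L l j) = offset L i l + offset L l j := by
    unfold offset; ring
  have hle : |((offset L i l + offset L l j : ℤ) : ℝ)| ≤ ρ + σ := by
    push_cast
    exact (abs_add_le _ _).trans (add_le_add h1 h2)
  have hw : wind L i l + wind L l j = wind L i j := by
    refine eq_wind ?_
    rw [e]
    have : 2 * |((offset L i l + offset L l j : ℤ) : ℝ)| < L := by linarith
    exact_mod_cast this
  refine ⟨hw, ?_⟩
  have : offset L i j = offset L i l + offset L l j := by rw [← e, hw, offset]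
  rwa [this]

variable {Lx Ly N : ℕ}

/-- Winding numbers in both directions of the shortest path from the cell of `b` to that of `a`. -/
def torusWind (a b : Orbital Lx Ly N) : ℤ × ℤ := (wind Lx a.1.1 b.1.1, wind Ly a.1.2 b.1.2)

/-- All matrix elements of `A` connect cells whose offsets in both directions are at most `ρ`. -/
def IsLocal (A : Matrix (Orbital Lx Ly N) (Orbital Lx Ly N) ℂ) (ρ : ℝ) : Prop :=
  ∀ a b, A a b ≠ 0 →
    |(offset Lx a.1.1 b.1.1 : ℝ)| ≤ ρ ∧ |(offset Ly a.1.2 b.1.2 : ℝ)| ≤ ρ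

/-- The twist of boundary conditions with formal twist factors. -/
def twist : Matrix (Orbital Lx Ly N) (Orbital Lx Ly N) ℂ →ₗ[ℂ]
    Matrix (Orbital Lx Ly N) (Orbital Lx Ly N) FluxRing where
  toFun A := Matrix.of fun a b => .single (torusWind a b) (A a b)
  map_add' A B := by ext1 a b; exact AddMonoidAlgebra.single_add ..
  map_smul' r A := by ext1 a b; exact (AddMonoidAlgebra.smul_single r (torusWind a b) (A a b)).symm

theorem twist_apply (A : Matrix (Orbital Lx Ly N) (Orbital Lx Ly N) ℂ) (a b : Orbital Lx Ly N) :
    twist A a b = .single (torusWind a b) (A a b) := rfl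

theorem torusWind_self (a : Orbital Lx Ly N) : torusWind a a = 0 := by
  simp [torusWind, wind_self]

theorem torusWind_swap (a b : Orbital Lx Ly N) : torusWind b a = -torusWind a b := by
  rw [torusWind, wind_swap, wind_swap Ly]; rfl

theorem trace_twist (A : Matrix (Orbital Lx Ly N) (Orbital Lx Ly N) ℂ) :
    (twist A).trace = algebraMap ℂ FluxRing A.trace := by
  simp only [Matrix.trace, Matrix.diag, twist_apply, torusWind_self, map_sum]
  rfl

theorem twist_one : twist (1 : Matrix (Orbital Lx Ly N) (Orbital Lx Ly N) ℂ) = 1 := by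
  ext1 a b
  rw [twist_apply]
  by_cases h : a = b
  · subst h
    rw [torusWind_self, Matrix.one_apply_eq, Matrix.one_apply_eq]
    rfl
  · rw [Matrix.one_apply_ne h, Matrix.one_apply_ne h, AddMonoidAlgebra.single_zero]

theorem isLocal_one : IsLocal (1 : Matrix (Orbital Lx Ly N) (Orbital Lx Ly N) ℂ) 0 := by
  intro a b h
  obtain rfl : a = b := by
    by_contra hab
    exact h (Matrix.one_apply_ne hab)
  simp [offset, wind_self]

/-- No path that is composed of one hop of `A` and one of `B` is long enough to wind around the
torus, so the formal twist is multiplicative on the product. -/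
theorem twist_mul {A B : Matrix (Orbital Lx Ly N) (Orbital Lx Ly N) ℂ} {ρ σ : ℝ} (hA : IsLocal A ρ)
    (hB : IsLocal B σ) (hx : 2 * (ρ + σ) < Lx) (hy : 2 * (ρ + σ) < Ly) :
    twist (A * B) = twist A * twist B ∧ IsLocal (A * B) (ρ + σ) := by
  constructor
  · ext1 a b
    rw [twist_apply, Matrix.mul_apply, Matrix.mul_apply,
      show AddMonoidAlgebra.single (torusWind a b) (∑ c, A a c * B c b)
        = ∑ c, AddMonoidAlgebra.single (torusWind a b) (A a c * B c b) from
        map_sum (AddMonoidAlgebra.singleAddHom (torusWind a b)) _ _]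
    refine Finset.sum_congr rfl fun c _ => ?_
    rw [twist_apply, twist_apply, AddMonoidAlgebra.single_mul_single]
    by_cases h : A a c * B c b = 0
    · rw [h, AddMonoidAlgebra.single_zero, AddMonoidAlgebra.single_zero]
    · have h1 := hA a c (left_ne_zero_of_mul h)
      have h2 := hB c b (right_ne_zero_of_mul h)
      congr 1
      exact (Prod.ext (wind_add h1.1 h2.1 hx).1 (wind_add h1.2 h2.2 hy).1).symm
  · intro a b h
    rw [Matrix.mul_apply] at h
    obtain ⟨c, -, hc⟩ := Finset.exists_ne_zero_of_sum_ne_zero h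
    have h1 := hA a c (left_ne_zero_of_mul hc)
    have h2 := hB c b (right_ne_zero_of_mul hc)
    exact ⟨(wind_add h1.1 h2.1 hx).2, (wind_add h1.2 h2.2 hy).2⟩

theorem twist_pow {A : Matrix (Orbital Lx Ly N) (Orbital Lx Ly N) ℂ} {ρ : ℝ} (hρ : 0 ≤ ρ)
    (hA : IsLocal A ρ) {n : ℕ} (hx : 2 * (n * ρ) < Lx) (hy : 2 * (n * ρ) < Ly) :
    twist (A ^ n) = twist A ^ n ∧ IsLocal (A ^ n) (n * ρ) := by
  induction n with
  | zero => simpa using ⟨twist_one, isLocal_one⟩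
  | succ n ih =>
    have e : ((n + 1 : ℕ) : ℝ) * ρ = n * ρ + ρ := by push_cast; ring
    rw [e] at hx hy ⊢
    obtain ⟨h1, h2⟩ := ih (by linarith) (by linarith)
    obtain ⟨h3, h4⟩ := twist_mul h2 hA hx hy
    rw [pow_succ, pow_succ, h3, h1]
    exact ⟨rfl, h4⟩

/-- Twisting commutes with polynomials of small degree in a local matrix. -/
theorem twist_aeval {A : Matrix (Orbital Lx Ly N) (Orbital Lx Ly N) ℂ} {ρ : ℝ} (hρ : 0 ≤ ρ)
    (hA : IsLocal A ρ) {n : ℕ} (hx : 2 * (n * ρ) < Lx) (hy : 2 * (n * ρ) < Ly) {p : Polynomial ℂ}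
    (hp : p.natDegree ≤ n) : twist (Polynomial.aeval A p) = Polynomial.aeval (twist A) p := by
  rw [Polynomial.aeval_eq_sum_range' (Nat.lt_succ_of_le hp),
    Polynomial.aeval_eq_sum_range' (Nat.lt_succ_of_le hp), map_sum]
  refine Finset.sum_congr rfl fun m hm => ?_
  have hle : (m : ℝ) * ρ ≤ n * ρ := by
    gcongr
    exact Nat.lt_succ_iff.mp (Finset.mem_range.mp hm)
  rw [map_smul, (twist_pow hρ hA (by linarith) (by linarith)).1]

theorem isLocal_hoppingRange (H : Matrix (Orbital Lx Ly N) (Orbital Lx Ly N) ℂ) :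
    IsLocal H (hoppingRange H) := by
  intro a b h
  have hd : torusDist a.1 b.1 ≤ hoppingRange H := by
    by_contra hlt
    exact h ((isLeast_hoppingRange H).1.2 a.1 b.1 a.2 b.2 (not_le.mp hlt))
  have e1 : |(offset Lx a.1.1 b.1.1 : ℝ)| = ringDist a.1.1 b.1.1 := by
    exact_mod_cast congrArg (Int.cast : ℤ → ℝ) (abs_offset a.1.1 b.1.1)
  have e2 : |(offset Ly a.1.2 b.1.2 : ℝ)| = ringDist a.1.2 b.1.2 := by
    exact_mod_cast congrArg (Int.cast : ℤ → ℝ) (abs_offset a.1.2 b.1.2)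
  rw [e1, e2]
  exact ⟨(Real.le_sqrt_of_sq_le (by nlinarith [sq_nonneg (ringDist a.1.2 b.1.2 : ℝ)])).trans hd,
    (Real.le_sqrt_of_sq_le (by nlinarith [sq_nonneg (ringDist a.1.1 b.1.1 : ℝ)])).trans hd⟩

theorem twistPhase_eq {L : ℕ} {R : ℝ} (hL : 3 * R ≤ L) (θ : ℝ) {i j : Fin L}
    (h : |(offset L i j : ℝ)| ≤ R) :
    twistPhase L R θ i j = Complex.exp (Complex.I * θ * wind L i j) := by
  have hi : (i : ℝ) + 1 ≤ L := by exact_mod_cast i.2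
  have hj : (j : ℝ) + 1 ≤ L := by exact_mod_cast j.2
  have hi0 : (0 : ℝ) ≤ i := by positivity
  have hj0 : (0 : ℝ) ≤ j := by positivity
  rw [abs_le] at h
  obtain ⟨h1, h2⟩ := h
  unfold offset at h1 h2
  push_cast at h1 h2
  rcases (by unfold wind; split_ifs <;> simp :
    wind L i j = 1 ∨ wind L i j = -1 ∨ wind L i j = 0) with hw | hw | hw
  all_goals
    rw [hw] at h1 h2 ⊢
    push_cast at h1 h2 ⊢
    unfold twistPhase
  · rw [if_neg (by rintro ⟨_, _⟩; linarith), if_pos ⟨by linarith, by linarith⟩, mul_one]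
  · rw [if_pos ⟨by linarith, by linarith⟩, mul_neg_one]
  · rw [if_neg (by rintro ⟨_, _⟩; linarith), if_neg (by rintro ⟨_, _⟩; linarith), mul_zero,
      Complex.exp_zero]

/-! ### Evaluation at real fluxes -/

/-- The phase angle `2π (p φ_x + q φ_y) / Φ₀` of the monomial `z^p w^q` at the flux `φ`. -/
def fluxAngle (Φ₀ : ℝ) (φ : ℝ × ℝ) (g : ℤ × ℤ) : ℝ :=
  2 * Real.pi * φ.1 / Φ₀ * g.1 + 2 * Real.pi * φ.2 / Φ₀ * g.2

/-- Evaluation of Laurent polynomials at the twist factors that belong to the flux `φ`. -/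
def fluxEval (Φ₀ : ℝ) (φ : ℝ × ℝ) : FluxRing →ₐ[ℂ] ℂ :=
  AddMonoidAlgebra.lift ℂ ℂ (ℤ × ℤ)
    { toFun := fun g => Complex.exp (Complex.I * fluxAngle Φ₀ φ g.toAdd)
      map_one' := by simp [fluxAngle]
      map_mul' := fun g h => by
        rw [← Complex.exp_add]
        congr 1
        simp only [fluxAngle, toAdd_mul, Prod.fst_add, Prod.snd_add]
        push_cast
        ring }

theorem fluxEval_single (Φ₀ : ℝ) (φ : ℝ × ℝ) (g : ℤ × ℤ) (r : ℂ) :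
    fluxEval Φ₀ φ (.single g r) = r * Complex.exp (Complex.I * fluxAngle Φ₀ φ g) := by
  rw [fluxEval, AddMonoidAlgebra.lift_single]
  rfl

theorem twisted_eq_map_twist (Φ₀ : ℝ) {H : Matrix (Orbital Lx Ly N) (Orbital Lx Ly N) ℂ}
    (hx : 3 * hoppingRange H ≤ Lx) (hy : 3 * hoppingRange H ≤ Ly) (φ : ℝ × ℝ) :
    twisted Φ₀ H φ = (twist H).map (fluxEval Φ₀ φ) := by
  ext a b
  rw [Matrix.map_apply, twist_apply, fluxEval_single]
  simp only [twisted, Matrix.of_apply]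
  by_cases h : H a b = 0
  · simp [h]
  · have hl := isLocal_hoppingRange H a b h
    rw [twistPhase_eq hx _ hl.1, twistPhase_eq hy _ hl.2, ← Complex.exp_add, mul_comm]
    congr 2
    simp only [fluxAngle, torusWind]
    push_cast
    ring

theorem fluxEval_twist_isHermitian (Φ₀ : ℝ) (φ : ℝ × ℝ)
    {A : Matrix (Orbital Lx Ly N) (Orbital Lx Ly N) ℂ} (hA : A.IsHermitian) :
    ((twist A).map (fluxEval Φ₀ φ)).IsHermitian := by
  ext a b
  rw [Matrix.conjTranspose_apply, Matrix.map_apply, Matrix.map_apply, twist_apply, twist_apply,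
    fluxEval_single, fluxEval_single, star_mul', hA.apply, torusWind_swap]
  congr 1
  rw [Complex.star_def, ← Complex.exp_conj, map_mul, Complex.conj_I, Complex.conj_ofReal]
  congr 1
  simp only [fluxAngle, Prod.fst_neg, Prod.snd_neg]
  push_cast
  ring

/-! ### Level projectors as polynomials in the Hamiltonian -/

open Polynomial in
/-- `p(M)` is the orthogonal projector onto the eigenspace of the Hermitian matrix `M` at `E`. -/
structure IsLevelPoly {ι : Type*} [Fintype ι] [DecidableEq ι] (M : Matrix ι ι ℂ) (E : ℝ)
    (p : Polynomial ℝ) : Prop where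
  isHermitian : M.IsHermitian
  eval_eq_one : p.eval E = 1
  aeval_mul_eq_zero : aeval M ((X - C E) * p) = 0

section Level

variable {ι : Type*} [Fintype ι] [DecidableEq ι] {M : Matrix ι ι ℂ} {E : ℝ} {p : Polynomial ℝ}

open Polynomial in
/-- The Lagrange polynomial of the level `E`; its degree is less than the number `n` of levels. -/
theorem exists_isLevelPoly (hM : M.IsHermitian) (hE : E ∈ spectrum ℝ M) :
    ∃ p : Polynomial ℝ, IsLevelPoly M E p ∧ p.natDegree + 1 ≤ (spectrum ℝ M).ncard := by
  classical
  have hfin : (spectrum ℝ M).Finite := Matrix.finite_real_spectrum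
  set S := hfin.toFinset with hS
  have hES : E ∈ S := hfin.mem_toFinset.mpr hE
  set c : ℝ := ∏ e ∈ S.erase E, (E - e)
  have hc : c ≠ 0 := Finset.prod_ne_zero_iff.mpr fun e he =>
    sub_ne_zero.mpr (Finset.ne_of_mem_erase he).symm
  refine ⟨C c⁻¹ * ∏ e ∈ S.erase E, (X - C e), ⟨hM, ?_, ?_⟩, ?_⟩
  · rw [eval_mul, eval_C, eval_prod]
    simp only [eval_sub, eval_X, eval_C]
    exact inv_mul_cancel₀ hc
  · rw [mul_left_comm, Finset.mul_prod_erase S (fun e => X - C e) hES,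
      ← cfc_polynomial _ M hM.isSelfAdjoint]
    rw [cfc_congr (g := fun _ => (0 : ℝ)), cfc_const_zero]
    intro e he
    simp only [eval_mul, eval_prod]
    rw [Finset.prod_eq_zero (hfin.mem_toFinset.mpr he) (by simp), mul_zero]
  · rw [Set.ncard_eq_toFinset_card _ hfin, ← Finset.card_erase_add_one hES]
    gcongr
    refine (natDegree_C_mul_le _ _).trans ?_
    rw [natDegree_prod_of_monic _ _ fun e _ => monic_X_sub_C e]
    simp

theorem mem_energySpace {v : EuclideanSpace ℂ ι} :
    v ∈ energySpace M E ↔ M.mulVec v.ofLp = (E : ℂ) • v.ofLp := by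
  rw [energySpace, Module.End.mem_eigenspace_iff, ← (WithLp.ofLp_injective 2).eq_iff]
  rfl

open Polynomial in
theorem IsLevelPoly.exists_sub_one_eq (h : IsLevelPoly M E p) :
    ∃ s : Polynomial ℝ, p - 1 = s * (X - C E) := by
  have hd : X - C E ∣ p - 1 := by
    rw [dvd_iff_isRoot, IsRoot, eval_sub, h.eval_eq_one, eval_one, sub_self]
  obtain ⟨s, hs⟩ := hd
  exact ⟨s, by rw [hs, mul_comm]⟩

theorem IsLevelPoly.isHermitian_aeval (h : IsLevelPoly M E p) :
    (Polynomial.aeval M p).IsHermitian := by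
  rw [← cfc_polynomial p M h.isHermitian.isSelfAdjoint]
  exact cfc_predicate _ M

theorem aeval_X_sub_C : Polynomial.aeval M (Polynomial.X - Polynomial.C E)
    = M - (E : ℂ) • (1 : Matrix ι ι ℂ) := by
  rw [map_sub, Polynomial.aeval_X, Polynomial.aeval_C, Algebra.algebraMap_eq_smul_one]
  congr 1

/-- If the columns of `B` form an orthonormal basis of the eigenspace at `E`, then `p(M) = B Bᴴ`. -/
theorem IsLevelPoly.aeval_eq (h : IsLevelPoly M E p) {k : ℕ} {w : Fin k → EuclideanSpace ℂ ι}
    (hw : Orthonormal ℂ w) (hspan : Submodule.span ℂ (Set.range w) = energySpace M E) :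
    ∃ B : Matrix ι (Fin k) ℂ, (∀ i b, B i b = w b i) ∧ B.conjTranspose * B = 1 ∧
      Polynomial.aeval M p = B * B.conjTranspose := by
  set P := Polynomial.aeval M p
  let B : Matrix ι (Fin k) ℂ := Matrix.of fun i b => w b i
  have hBB : B.conjTranspose * B = 1 := by
    ext a b
    rw [Matrix.mul_apply, Matrix.one_apply, ← (orthonormal_iff_ite.mp hw a b), PiLp.inner_apply]
    refine Finset.sum_congr rfl fun i _ => ?_
    simp [B, mul_comm]
  refine ⟨B, fun _ _ => rfl, hBB, ?_⟩
  have hfix : ∀ v ∈ energySpace M E, (B * B.conjTranspose).mulVec v.ofLp = v.ofLp := by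
    intro v hv
    rw [← hspan] at hv
    induction hv using Submodule.span_induction with
    | mem x hx =>
      obtain ⟨b, rfl⟩ := hx
      have hcol : (w b).ofLp = B.mulVec (Pi.single b 1) := by
        ext i
        simp [B]
      rw [hcol, Matrix.mulVec_mulVec, Matrix.mul_assoc, hBB, Matrix.mul_one]
    | zero => simp
    | add x y _ _ hx hy => rw [WithLp.ofLp_add, Matrix.mulVec_add, hx, hy]
    | smul r x _ hx => rw [WithLp.ofLp_smul, Matrix.mulVec_smul, hx]
  -- The two projectors absorb each other, in opposite orders; as both are Hermitian, they agree.
  have h1 : B * B.conjTranspose * P = P := by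
    refine Matrix.ext_of_mulVec_single fun j => ?_
    rw [← Matrix.mulVec_mulVec]
    refine hfix (WithLp.toLp 2 (P.mulVec (Pi.single j 1))) (mem_energySpace.mpr ?_)
    have hz := h.aeval_mul_eq_zero
    rw [map_mul, aeval_X_sub_C, sub_mul, sub_eq_zero, Matrix.smul_mul, one_mul] at hz
    change M.mulVec (P.mulVec _) = (E : ℂ) • P.mulVec _
    rw [Matrix.mulVec_mulVec, hz, Matrix.smul_mulVec]
  have h2 : P * B = B := by
    obtain ⟨s, hs⟩ := h.exists_sub_one_eq
    have hMB : (M - (E : ℂ) • (1 : Matrix ι ι ℂ)) * B = 0 := by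
      ext i b
      have hb : w b ∈ energySpace M E := hspan ▸ Submodule.subset_span ⟨b, rfl⟩
      have := congrFun (mem_energySpace.mp hb) i
      rw [Matrix.sub_mul, Matrix.smul_mul, Matrix.one_mul, Matrix.sub_apply, Matrix.zero_apply,
        sub_eq_zero]
      exact this
    have : (P - 1) * B = 0 := by
      have e : P - 1 = Polynomial.aeval M (p - 1) := by rw [map_sub, map_one]
      rw [e, hs, map_mul, aeval_X_sub_C, Matrix.mul_assoc, hMB, Matrix.mul_zero]
    rwa [Matrix.sub_mul, Matrix.one_mul, sub_eq_zero] at this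
  have h3 := congrArg Matrix.conjTranspose h1
  rw [Matrix.conjTranspose_mul, Matrix.conjTranspose_mul, Matrix.conjTranspose_conjTranspose,
    h.isHermitian_aeval.eq, ← Matrix.mul_assoc, h2] at h3
  exact h3.symm

theorem exists_orthonormal_energySpace (M : Matrix ι ι ℂ) (E : ℝ) :
    ∃ w : Fin (Module.finrank ℂ (energySpace M E)) → EuclideanSpace ℂ ι, Orthonormal ℂ w ∧
      Submodule.span ℂ (Set.range w) = energySpace M E := by
  let b := stdOrthonormalBasis ℂ (energySpace M E)
  refine ⟨fun i => b i, b.orthonormal.comp_linearIsometry (energySpace M E).subtypeₗᵢ, ?_⟩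
  have : Set.range (fun i => (b i : EuclideanSpace ℂ ι))
      = (energySpace M E).subtype '' Set.range b := by
    rw [← Set.range_comp]; rfl
  rw [this, Submodule.span_image, ← b.coe_toBasis, b.toBasis.span_eq, Submodule.map_subtype_top]

theorem IsLevelPoly.trace_aeval (h : IsLevelPoly M E p) :
    (Polynomial.aeval M p).trace = Module.finrank ℂ (energySpace M E) := by
  obtain ⟨w, hw, hspan⟩ := exists_orthonormal_energySpace M E
  obtain ⟨B, -, hB, hP⟩ := h.aeval_eq hw hspan
  rw [hP, Matrix.trace_mul_comm, hB, Matrix.trace_one, Fintype.card_fin]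

theorem filledStates_nonempty {k : ℕ} (hk : Module.finrank ℂ (energySpace M E) = k) :
    (filledStates M E k).Nonempty := by
  subst hk
  obtain ⟨w, hw, hspan⟩ := exists_orthonormal_energySpace M E
  exact ⟨_, w, hw, hspan, rfl⟩

/-- The many-body projector of a completely filled level is `|Ψ⟩⟨Ψ|`, whatever the phase of `Ψ`. -/
theorem IsLevelPoly.slaterProj_eq (h : IsLevelPoly M E p) {k : ℕ}
    {Ψ : EuclideanSpace ℂ (Fin k → ι)} (hΨ : Ψ ∈ filledStates M E k) :
    slaterProj k (Polynomial.aeval M p) = Matrix.vecMulVec Ψ.ofLp (star Ψ.ofLp) ∧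
      star Ψ.ofLp ⬝ᵥ Ψ.ofLp = 1 := by
  obtain ⟨w, hw, hspan, rfl⟩ := hΨ
  obtain ⟨B, hBw, hB, hP⟩ := h.aeval_eq hw hspan
  have hk : ((Real.sqrt (k.factorial : ℝ) : ℂ))⁻¹ * ((Real.sqrt (k.factorial : ℝ) : ℂ))⁻¹
      = ((k.factorial : ℂ))⁻¹ := by
    rw [← mul_inv, ← Complex.ofReal_mul, Real.mul_self_sqrt (by positivity), Complex.ofReal_natCast]
  have hs : ∀ s : Fin k → ι, (slater w).ofLp s
      = ((Real.sqrt (k.factorial : ℝ) : ℂ))⁻¹ * (Matrix.of fun a b => B (s a) b).det := by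
    intro s
    simp only [slater, hBw]
  have hstar : ∀ s : Fin k → ι, star ((slater w).ofLp s)
      = ((Real.sqrt (k.factorial : ℝ) : ℂ))⁻¹ *
        (Matrix.of fun a b => B.conjTranspose a (s b)).det := by
    intro s
    rw [hs, star_mul', star_inv₀, Complex.star_def, Complex.conj_ofReal, ← Complex.star_def,
      ← Matrix.det_conjTranspose]
    rfl
  constructor
  · rw [hP, slaterProj_mul]
    ext s t
    rw [Matrix.vecMulVec_apply, Matrix.vecMulVec_apply, Pi.star_apply, hs, hstar, smul_eq_mul, ← hk]
    ring
  · rw [← dotProduct_slater_minors hB]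
    simp only [dotProduct, Pi.star_apply]
    refine Finset.sum_congr rfl fun s _ => ?_
    rw [hstar, hs, smul_eq_mul, ← hk]
    ring

/-- A filled state can be multiplied by a phase, which is absorbed in one of the wavefunctions. -/
theorem smul_mem_filledStates {k : ℕ} (hk : 0 < k) {Ψ : EuclideanSpace ℂ (Fin k → ι)}
    (hΨ : Ψ ∈ filledStates M E k) {z : ℂ} (hz : ‖z‖ = 1) : z • Ψ ∈ filledStates M E k := by
  classical
  obtain ⟨w, hw, hspan, rfl⟩ := hΨ
  let u : Fin k → ℂ := Function.update 1 ⟨0, hk⟩ z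
  have hu : ∀ b, ‖u b‖ = 1 := by
    intro b
    by_cases hb : b = ⟨0, hk⟩
    · subst hb; simp [u, hz]
    · simp [u, hb]
  have hu0 : ∀ b, u b ≠ 0 := fun b h0 => by simpa [h0] using hu b
  refine ⟨fun b => u b • w b, ?_, ?_, ?_⟩
  · refine ⟨fun b => by rw [norm_smul, hu, hw.1, one_mul], fun a b hab => ?_⟩
    change inner ℂ (u a • w a) (u b • w b) = 0
    rw [inner_smul_left, inner_smul_right, hw.2 hab, mul_zero, mul_zero]
  · rw [← hspan]
    apply le_antisymm
    · rw [Submodule.span_le]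
      rintro _ ⟨b, rfl⟩
      exact Submodule.smul_mem _ _ (Submodule.subset_span ⟨b, rfl⟩)
    · rw [Submodule.span_le]
      rintro _ ⟨b, rfl⟩
      have := Submodule.smul_mem (Submodule.span ℂ (Set.range fun b => u b • w b)) (u b)⁻¹
        (Submodule.subset_span ⟨b, rfl⟩)
      simpa [smul_smul, inv_mul_cancel₀ (hu0 b)] using this
  · ext s
    have hdet : (Matrix.of fun a b : Fin k => (u b • w b) (s a)).det
        = z * (Matrix.of fun a b : Fin k => w b (s a)).det := by
      have hprod : ∏ b, u b = z := by
        rw [Finset.prod_eq_single ⟨0, hk⟩] <;> simp +contextual [u]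
      rw [← hprod, ← Matrix.det_mul_row]
      rfl
    simp only [slater, PiLp.smul_apply, smul_eq_mul] at hdet ⊢
    rw [hdet]
    ring

theorem finrank_energySpace_pos (hM : M.IsHermitian) (hE : E ∈ spectrum ℝ M) :
    0 < Module.finrank ℂ (energySpace M E) := by
  rw [hM.spectrum_real_eq_range_eigenvalues] at hE
  obtain ⟨i, rfl⟩ := hE
  have hmem : hM.eigenvectorBasis i ∈ energySpace M (hM.eigenvalues i) := by
    rw [mem_energySpace, hM.mulVec_eigenvectorBasis]
    rfl
  have : Nontrivial (energySpace M (hM.eigenvalues i)) :=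
    ⟨⟨⟨_, hmem⟩, 0, fun h => hM.eigenvectorBasis.orthonormal.ne_zero i (congrArg Subtype.val h)⟩⟩
  exact Module.finrank_pos

end Level

/-! ### Berry curvature of a twisted family -/

/-- The exponent-counting function whose logarithmic derivative is, up to the factor `2πi / Φ₀`, the
derivative along `e` with respect to the flux. -/
def fluxDir (e : ℝ × ℝ) : ℤ × ℤ →+ ℂ where
  toFun g := e.1 * g.1 + e.2 * g.2
  map_zero' := by simp
  map_add' g h := by
    simp only [Prod.fst_add, Prod.snd_add]
    push_cast
    ring

/-- A monomial is the exponential of a linear function of the flux. -/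
theorem exists_fluxEval_single_eq_exp (Φ₀ : ℝ) (g : ℤ × ℤ) (r : ℂ) :
    ∃ A : ℝ × ℝ →L[ℝ] ℂ, (∀ φ, Complex.I * fluxAngle Φ₀ φ g = A φ) ∧
      (∀ e, A e = 2 * Real.pi * Complex.I / Φ₀ * fluxDir e g) ∧
      ∀ φ, fluxEval Φ₀ φ (.single g r) = r * Complex.exp (A φ) := by
  let B : ℝ × ℝ →L[ℝ] ℝ := (2 * Real.pi / Φ₀ * g.1) • ContinuousLinearMap.fst ℝ ℝ ℝ
    + (2 * Real.pi / Φ₀ * g.2) • ContinuousLinearMap.snd ℝ ℝ ℝ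
  have h : ∀ φ, Complex.I * fluxAngle Φ₀ φ g = (Complex.I • Complex.ofRealCLM.comp B) φ := by
    intro φ
    simp only [fluxAngle, B, smul_apply, ContinuousLinearMap.comp_apply,
      add_apply, ContinuousLinearMap.coe_fst', ContinuousLinearMap.coe_snd',
      Complex.ofRealCLM_apply, smul_eq_mul]
    push_cast
    ring
  refine ⟨Complex.I • Complex.ofRealCLM.comp B, h, fun e => ?_, fun φ => ?_⟩
  · rw [← h]
    simp only [fluxAngle, fluxDir, AddMonoidHom.coe_mk, ZeroHom.coe_mk]
    push_cast
    ring
  · rw [fluxEval_single, h]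

theorem contDiff_fluxEval (Φ₀ : ℝ) (f : FluxRing) :
    ContDiff ℝ ∞ fun φ : ℝ × ℝ => fluxEval Φ₀ φ f := by
  induction f using AddMonoidAlgebra.induction_linear with
  | zero => simpa using contDiff_const
  | add f h hf hh => simpa only [map_add] using hf.add hh
  | single g r =>
    obtain ⟨A, -, -, hA⟩ := exists_fluxEval_single_eq_exp Φ₀ g r
    simp only [hA]
    exact contDiff_const.mul A.contDiff.cexp

theorem fderiv_fluxEval (Φ₀ : ℝ) (f : FluxRing) (φ e : ℝ × ℝ) :
    fderiv ℝ (fun φ : ℝ × ℝ => fluxEval Φ₀ φ f) φ e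
      = 2 * Real.pi * Complex.I / Φ₀ * fluxEval Φ₀ φ (f.deriv (fluxDir e)) := by
  have hd : ∀ f : FluxRing, DifferentiableAt ℝ (fun φ : ℝ × ℝ => fluxEval Φ₀ φ f) φ := fun f =>
    (contDiff_fluxEval Φ₀ f).differentiable (by simp) φ
  induction f using AddMonoidAlgebra.induction_linear with
  | zero => simp [FluxRing.deriv_zero]
  | add f h hf hh =>
    simp only [map_add, FluxRing.deriv_add, mul_add]
    rw [fderiv_fun_add (hd f) (hd h), add_apply, hf, hh]
  | single g r =>
    obtain ⟨A, hA0, hA, hA'⟩ := exists_fluxEval_single_eq_exp Φ₀ g r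
    rw [FluxRing.deriv_single, fluxEval_single, hA0]
    simp only [hA']
    have h1 := (A.hasFDerivAt (x := φ)).cexp.const_mul r
    rw [h1.fderiv]
    simp only [smul_apply, smul_eq_mul, hA]
    ring

/-- The curl of the Berry connection in terms of first derivatives only. -/
theorem berryCurl_eq {V : Type*} [NormedAddCommGroup V] [InnerProductSpace ℂ V] [NormedSpace ℝ V]
    {Ψ : ℝ × ℝ → V} {φ : ℝ × ℝ} (h : ContDiffAt ℝ 2 Ψ φ) :
    berryCurl Ψ φ = Complex.I * (inner ℂ (fderiv ℝ Ψ φ (1, 0)) (fderiv ℝ Ψ φ (0, 1))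
      - inner ℂ (fderiv ℝ Ψ φ (0, 1)) (fderiv ℝ Ψ φ (1, 0))) := by
  have hΨ : DifferentiableAt ℝ Ψ φ := h.differentiableAt (by norm_num)
  have hD : DifferentiableAt ℝ (fderiv ℝ Ψ) φ :=
    (h.fderiv_right (m := 1) (by norm_num)).differentiableAt (by norm_num)
  have key : ∀ e e' : ℝ × ℝ, fderiv ℝ (berryConnection Ψ e) φ e'
      = Complex.I * (inner ℂ (Ψ φ) (fderiv ℝ (fderiv ℝ Ψ) φ e' e)
        + inner ℂ (fderiv ℝ Ψ φ e') (fderiv ℝ Ψ φ e)) := by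
    intro e e'
    have he : DifferentiableAt ℝ (fun x => fderiv ℝ Ψ x e) φ :=
      hD.clm_apply (differentiableAt_const e)
    have he' : fderiv ℝ (fun x => fderiv ℝ Ψ x e) φ e' = fderiv ℝ (fderiv ℝ Ψ) φ e' e := by
      rw [fderiv_clm_apply hD (differentiableAt_const e)]
      simp
    unfold berryConnection
    rw [fderiv_const_mul (hΨ.inner ℂ he), smul_apply,
      fderiv_inner_apply ℂ hΨ he, he', smul_eq_mul]
  have hsymm : IsSymmSndFDerivAt ℝ Ψ φ := h.isSymmSndFDerivAt (by simp)
  unfold berryCurl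
  rw [key, key, hsymm.eq (1, 0) (0, 1)]
  ring

section Family

variable {κ : Type*} [Fintype κ]

theorem inner_eq_conj_dotProduct (x y : EuclideanSpace ℂ κ) :
    inner ℂ x y = star x.ofLp ⬝ᵥ y.ofLp := by
  rw [EuclideanSpace.inner_eq_star_dotProduct, dotProduct_comm]

/-- The Berry curvature of a gauge of a family of pure states, in terms of the projectors
`|Ψ⟩⟨Ψ|`, which do not depend on the gauge. -/
theorem berryCurl_eq_fluxEval {Φ₀ : ℝ} {Q : Matrix κ κ FluxRing}
    {U : Set (ℝ × ℝ)} (hU : IsOpen U) {Ψ : ℝ × ℝ → EuclideanSpace ℂ κ} (hΨ : ContDiffOn ℝ ∞ Ψ U)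
    (hQ : ∀ φ ∈ U, Q.map (fluxEval Φ₀ φ) = Matrix.vecMulVec (Ψ φ).ofLp (star (Ψ φ).ofLp))
    (h1 : ∀ φ ∈ U, star (Ψ φ).ofLp ⬝ᵥ (Ψ φ).ofLp = 1) {φ : ℝ × ℝ} (hφ : φ ∈ U) :
    berryCurl Ψ φ = Complex.I * ((2 * Real.pi * Complex.I / Φ₀) ^ 2 *
      fluxEval Φ₀ φ (fluxCurvature (fluxDir (1, 0)) (fluxDir (0, 1)) Q)) := by
  classical
  have hUφ : U ∈ nhds φ := hU.mem_nhds hφ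
  have hc : ContDiffAt ℝ ∞ Ψ φ := hΨ.contDiffAt hUφ
  have hdiff : DifferentiableAt ℝ Ψ φ := hc.differentiableAt (by simp)
  set ψ : κ → ℂ := (Ψ φ).ofLp with hψ
  let D : ℝ × ℝ → κ → ℂ := fun e => (fderiv ℝ Ψ φ e).ofLp
  have hcoord : ∀ s, HasFDerivAt (fun x => (Ψ x).ofLp s)
      ((PiLp.proj (𝕜 := ℝ) 2 (fun _ : κ => ℂ) s).comp (fderiv ℝ Ψ φ)) φ := fun s =>
    (PiLp.proj (𝕜 := ℝ) 2 (fun _ : κ => ℂ) s).hasFDerivAt.comp φ hdiff.hasFDerivAt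
  have hstar : ∀ s, HasFDerivAt (fun x => star ((Ψ x).ofLp s))
      ((starL' ℝ : ℂ ≃L[ℝ] ℂ).toContinuousLinearMap.comp
        ((PiLp.proj (𝕜 := ℝ) 2 (fun _ : κ => ℂ) s).comp (fderiv ℝ Ψ φ))) φ := fun s =>
    (starL' ℝ : ℂ ≃L[ℝ] ℂ).toContinuousLinearMap.hasFDerivAt.comp φ (hcoord s)
  have hQd : ∀ e, (2 * Real.pi * Complex.I / Φ₀) • (Q.map (FluxRing.deriv (fluxDir e))).map
      (fluxEval Φ₀ φ) = Matrix.vecMulVec (D e) (star ψ) + Matrix.vecMulVec ψ (star (D e)) := by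
    intro e
    ext s t
    rw [Matrix.smul_apply, Matrix.map_apply, Matrix.map_apply, smul_eq_mul, ← fderiv_fluxEval]
    have hev : (fun x => fluxEval Φ₀ x (Q s t))
        =ᶠ[nhds φ] fun x => (Ψ x).ofLp s * star ((Ψ x).ofLp t) := by
      filter_upwards [hUφ] with x hx
      exact congrFun (congrFun (hQ x hx) s) t
    have hmul : HasFDerivAt (fun x => (Ψ x).ofLp s * star ((Ψ x).ofLp t)) _ φ :=
      (hcoord s).mul (hstar t)
    rw [hev.fderiv_eq, hmul.fderiv]
    simp only [add_apply, smul_apply, smul_eq_mul,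
      Matrix.add_apply, Matrix.vecMulVec_apply, Pi.star_apply]
    change ψ s * star (D e t) + star (ψ t) * D e s = _
    ring
  have h1d : ∀ e, star (D e) ⬝ᵥ ψ + star ψ ⬝ᵥ D e = 0 := by
    intro e
    have hev : (fun x => inner ℂ (Ψ x) (Ψ x)) =ᶠ[nhds φ] fun _ => (1 : ℂ) := by
      filter_upwards [hUφ] with x hx
      rw [inner_eq_conj_dotProduct, h1 x hx]
    have := fderiv_inner_apply ℂ hdiff hdiff e
    rw [hev.fderiv_eq, fderiv_fun_const, inner_eq_conj_dotProduct,
      inner_eq_conj_dotProduct] at this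
    rw [add_comm]
    exact this.symm
  -- `Q` has rank one near `φ`, with `ψ` and `star ψ` as its two factors.
  have hcurv : (2 * Real.pi * Complex.I / Φ₀) ^ 2 *
      fluxEval Φ₀ φ (fluxCurvature (fluxDir (1, 0)) (fluxDir (0, 1)) Q)
      = star (D (1, 0)) ⬝ᵥ D (0, 1) - star (D (0, 1)) ⬝ᵥ D (1, 0) := by
    rw [← trace_rankOne_commutator (h1 φ hφ) (h1d _) (h1d _), ← hQd, ← hQd, ← hψ, ← hQ φ hφ]
    have : fluxEval Φ₀ φ (fluxCurvature (fluxDir (1, 0)) (fluxDir (0, 1)) Q)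
        = (Q.map (fluxEval Φ₀ φ) *
          ((Q.map (FluxRing.deriv (fluxDir (1, 0)))).map (fluxEval Φ₀ φ) *
              (Q.map (FluxRing.deriv (fluxDir (0, 1)))).map (fluxEval Φ₀ φ)
            - (Q.map (FluxRing.deriv (fluxDir (0, 1)))).map (fluxEval Φ₀ φ) *
              (Q.map (FluxRing.deriv (fluxDir (1, 0)))).map (fluxEval Φ₀ φ))).trace := by
      simp only [← Matrix.map_mul]
      rw [← Matrix.map_sub (f := fluxEval Φ₀ φ) (fun a b => map_sub _ a b), ← Matrix.map_mul]
      simp only [fluxCurvature, Matrix.trace, Matrix.diag, map_sum, Matrix.map_apply]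
    rw [this]
    simp only [Matrix.smul_mul, Matrix.mul_smul, smul_smul, ← smul_sub, Matrix.trace_smul,
      smul_eq_mul]
    ring
  rw [berryCurl_eq (hc.of_le (WithTop.coe_le_coe.mpr (le_top : (2 : ℕ∞) ≤ ⊤))), hcurv,
    inner_eq_conj_dotProduct, inner_eq_conj_dotProduct]

/-- A family of rays of states whose projectors are Laurent polynomials in the twist factors has a
Berry curvature. -/
theorem isBerryCurvature_of_projector {Φ₀ : ℝ} {Q : Matrix κ κ FluxRing}
    {S : ℝ × ℝ → Set (EuclideanSpace ℂ κ)} (hne : ∀ φ, (S φ).Nonempty)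
    (hphase : ∀ φ, ∀ Ψ ∈ S φ, ∀ z : ℂ, ‖z‖ = 1 → z • Ψ ∈ S φ)
    (hQ : ∀ φ, ∀ Ψ ∈ S φ, Q.map (fluxEval Φ₀ φ) = Matrix.vecMulVec Ψ.ofLp (star Ψ.ofLp))
    (h1 : ∀ φ, ∀ Ψ ∈ S φ, star Ψ.ofLp ⬝ᵥ Ψ.ofLp = 1) :
    IsBerryCurvature S fun φ => Complex.I * ((2 * Real.pi * Complex.I / Φ₀) ^ 2 *
      fluxEval Φ₀ φ (fluxCurvature (fluxDir (1, 0)) (fluxDir (0, 1)) Q)) := by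
  intro φ₀
  refine ⟨?_, fun U Ψ hφ hG => (berryCurl_eq_fluxEval hG.isOpen hG.smooth
    (fun φ hφ => hQ φ _ (hG.mem φ hφ)) (fun φ hφ => h1 φ _ (hG.mem φ hφ)) hφ).symm⟩
  obtain ⟨Ψ₀, hΨ₀⟩ := hne φ₀
  -- The projection of the state at `φ₀` is a smooth section; it is normalized where it is nonzero.
  let v : ℝ × ℝ → EuclideanSpace ℂ κ := fun φ =>
    WithLp.toLp 2 ((Q.map (fluxEval Φ₀ φ)).mulVec Ψ₀.ofLp)
  have hv : ContDiff ℝ ∞ v := by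
    refine contDiff_piLp 2 |>.mpr fun s => ?_
    change ContDiff ℝ ∞ fun φ => ∑ t, fluxEval Φ₀ φ (Q s t) * Ψ₀.ofLp t
    exact ContDiff.sum fun t _ => (contDiff_fluxEval Φ₀ (Q s t)).mul contDiff_const
  have hvS : ∀ φ, ∀ Ψ ∈ S φ, v φ = (star Ψ.ofLp ⬝ᵥ Ψ₀.ofLp) • Ψ := by
    intro φ Ψ hΨ
    apply WithLp.ofLp_injective 2
    change (Q.map (fluxEval Φ₀ φ)).mulVec Ψ₀.ofLp = _
    rw [hQ φ Ψ hΨ, Matrix.vecMulVec_mulVec]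
    ext s
    simp [mul_comm]
  have hnorm : ∀ φ, ∀ Ψ ∈ S φ, ‖Ψ‖ = 1 := by
    intro φ Ψ hΨ
    have h := h1 φ Ψ hΨ
    rw [← inner_eq_conj_dotProduct, inner_self_eq_norm_sq_to_K] at h
    have h' : ‖Ψ‖ ^ 2 = 1 := Complex.ofReal_injective (by push_cast; exact h)
    exact (pow_eq_one_iff_of_nonneg (norm_nonneg _) two_ne_zero).mp h'
  refine ⟨{φ | v φ ≠ 0}, fun φ => (‖v φ‖⁻¹ : ℝ) • v φ, ?_, ?_, ?_, ?_⟩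
  · change v φ₀ ≠ 0
    rw [hvS φ₀ Ψ₀ hΨ₀, h1 φ₀ Ψ₀ hΨ₀, one_smul, ← norm_ne_zero_iff, hnorm φ₀ Ψ₀ hΨ₀]
    exact one_ne_zero
  · exact isOpen_ne_fun hv.continuous continuous_const
  · intro φ hφ
    have hφ' : v φ ≠ 0 := hφ
    exact (((hv.contDiffAt.norm ℂ hφ').inv (norm_ne_zero_iff.mpr hφ')).smul
      hv.contDiffAt).contDiffWithinAt
  · intro φ hφ
    have hφ' : v φ ≠ 0 := hφ
    obtain ⟨Ψ, hΨ⟩ := hne φ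
    set c := star Ψ.ofLp ⬝ᵥ Ψ₀.ofLp
    have hvc : v φ = c • Ψ := hvS φ Ψ hΨ
    have hc : ‖v φ‖ = ‖c‖ := by rw [hvc, norm_smul, hnorm φ Ψ hΨ, mul_one]
    have e : (‖v φ‖⁻¹ : ℝ) • v φ = (((‖c‖⁻¹ : ℝ) : ℂ) * c) • Ψ := by
      rw [hc, hvc, mul_smul]
      rfl
    change (‖v φ‖⁻¹ : ℝ) • v φ ∈ S φ
    rw [e]
    refine hphase φ Ψ hΨ _ ?_
    rw [norm_mul, Complex.norm_real, norm_inv, norm_norm, ← hc]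
    exact inv_mul_cancel₀ (norm_ne_zero_iff.mpr hφ')

end Family

/-! ### Averages over the flux torus -/

theorem setIntegral_exp_flux {Φ₀ : ℝ} (hΦ₀ : 0 < Φ₀) {m : ℤ} (hm : m ≠ 0) :
    ∫ x in Set.Icc 0 Φ₀, Complex.exp (2 * Real.pi * Complex.I * m / Φ₀ * (x : ℂ)) = 0 := by
  have hΦ : (Φ₀ : ℂ) ≠ 0 := by exact_mod_cast hΦ₀.ne'
  have hm' : (m : ℂ) ≠ 0 := by exact_mod_cast hm
  have hpi : (Real.pi : ℂ) ≠ 0 := by exact_mod_cast Real.pi_ne_zero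
  have hc : 2 * Real.pi * Complex.I * m / Φ₀ ≠ 0 := by
    simp [hΦ, hm', hpi, Complex.I_ne_zero]
  rw [MeasureTheory.integral_Icc_eq_integral_Ioc, ← intervalIntegral.integral_of_le hΦ₀.le,
    integral_exp_mul_complex hc, div_mul_cancel₀ _ hΦ,
    show 2 * Real.pi * Complex.I * m = m * (2 * Real.pi * Complex.I) by ring,
    Complex.exp_int_mul_two_pi_mul_I]
  simp

theorem integrableOn_fluxEval (Φ₀ : ℝ) (f : FluxRing) :
    MeasureTheory.IntegrableOn (fun φ => fluxEval Φ₀ φ f) (Set.Icc 0 Φ₀ ×ˢ Set.Icc 0 Φ₀) :=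
  (contDiff_fluxEval Φ₀ f).continuous.continuousOn.integrableOn_compact
    (isCompact_Icc.prod isCompact_Icc)

/-- The average of a Laurent polynomial over the flux torus is its constant term. -/
theorem setIntegral_fluxEval {Φ₀ : ℝ} (hΦ₀ : 0 < Φ₀) (f : FluxRing) :
    ∫ φ in Set.Icc 0 Φ₀ ×ˢ Set.Icc 0 Φ₀, fluxEval Φ₀ φ f = (Φ₀ : ℂ) ^ 2 * f.coeff 0 := by
  induction f using AddMonoidAlgebra.induction_linear with
  | zero => simp
  | add f h hf hh =>
    simp only [map_add]
    rw [MeasureTheory.integral_add (integrableOn_fluxEval Φ₀ f) (integrableOn_fluxEval Φ₀ h),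
      hf, hh]
    simp [mul_add]
  | single g r =>
    have hsplit : ∀ φ : ℝ × ℝ, fluxEval Φ₀ φ (.single g r)
        = (r * Complex.exp (2 * Real.pi * Complex.I * g.1 / Φ₀ * (φ.1 : ℂ))) *
          Complex.exp (2 * Real.pi * Complex.I * g.2 / Φ₀ * (φ.2 : ℂ)) := by
      intro φ
      rw [fluxEval_single, mul_assoc, ← Complex.exp_add]
      congr 2
      simp only [fluxAngle]
      push_cast
      ring
    simp only [hsplit]
    rw [MeasureTheory.Measure.volume_eq_prod, MeasureTheory.setIntegral_prod_mul
      (fun x : ℝ => r * Complex.exp (2 * Real.pi * Complex.I * g.1 / Φ₀ * (x : ℂ)))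
      (fun x : ℝ => Complex.exp (2 * Real.pi * Complex.I * g.2 / Φ₀ * (x : ℂ))),
      MeasureTheory.integral_const_mul]
    obtain ⟨m, n⟩ := g
    by_cases hm : m = 0
    · by_cases hn : n = 0
      · subst hm hn
        simp only [Int.cast_zero, mul_zero, zero_div, zero_mul, Complex.exp_zero]
        rw [MeasureTheory.setIntegral_const, show ((0 : ℤ), (0 : ℤ)) = 0 from rfl,
          AddMonoidAlgebra.coeff_single, Finsupp.single_eq_same]
        simp [hΦ₀.le]
        ring
      · rw [setIntegral_exp_flux hΦ₀ hn]
        simp [hn]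
    · rw [setIntegral_exp_flux hΦ₀ hm]
      simp [hm]

/-! ### The levels of a flat Hamiltonian -/

variable {H : Matrix (Orbital Lx Ly N) (Orbital Lx Ly N) ℂ} {E : ℝ}

theorem map_aeval_fluxEval {ι : Type*} [Fintype ι] [DecidableEq ι] (Φ₀ : ℝ) (φ : ℝ × ℝ)
    (A : Matrix ι ι FluxRing) (p : Polynomial ℂ) :
    (Polynomial.aeval A p).map (fluxEval Φ₀ φ) = Polynomial.aeval (A.map (fluxEval Φ₀ φ)) p :=
  (Polynomial.aeval_algHom_apply (fluxEval Φ₀ φ).mapMatrix A p).symm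

/-- The projector onto the level `E` of a Hamiltonian on a large torus depends on the twist factors
like the twist of the projector at zero flux, and `E` remains a level for all fluxes. -/
theorem exists_twisted_projector (hH : H.IsHermitian) (hE : E ∈ spectrum ℝ H)
    (hLx : 3 * ((spectrum ℝ H).ncard : ℝ) * hoppingRange H ≤ (Lx : ℝ))
    (hLy : 3 * ((spectrum ℝ H).ncard : ℝ) * hoppingRange H ≤ (Ly : ℝ)) (Φ₀ : ℝ) :
    ∃ (p : Polynomial ℝ) (P : Matrix (Orbital Lx Ly N) (Orbital Lx Ly N) FluxRing),
      P * P = P ∧ P.trace = Module.finrank ℂ (energySpace H E) ∧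
      ∀ φ, IsLevelPoly (twisted Φ₀ H φ) E p ∧
        Polynomial.aeval (twisted Φ₀ H φ) p = P.map (fluxEval Φ₀ φ) ∧
        Module.finrank ℂ (energySpace (twisted Φ₀ H φ) E) = Module.finrank ℂ (energySpace H E) := by
  obtain ⟨p, hp, hdeg⟩ := exists_isLevelPoly hH hE
  set n := (spectrum ℝ H).ncard with hn
  set R := hoppingRange H with hRdef
  have hR : 0 ≤ R := (isLeast_hoppingRange H).1.1
  have hn1 : (1 : ℝ) ≤ n := by exact_mod_cast (Nat.le_add_left 1 _).trans hdeg
  -- The no-winding condition is strict, so `R = 0` needs a separate argument.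
  have hsize : ∀ L : ℕ, 0 < L → 3 * (n : ℝ) * R ≤ L → 2 * (n * R) < L ∧ 3 * R ≤ L := by
    intro L hL h
    have hL' : (0 : ℝ) < L := by exact_mod_cast hL
    have hnR : R ≤ n * R := le_mul_of_one_le_left hR hn1
    constructor
    · rcases hR.eq_or_lt with h0 | h0
      · rw [← h0]; simpa using hL'
      · nlinarith
    · nlinarith
  have hpos : 0 < Lx ∧ 0 < Ly := by
    have : Nonempty (Orbital Lx Ly N) := by
      by_contra hempty
      rw [not_nonempty_iff] at hempty
      exact (finrank_energySpace_pos hH hE).ne' Module.finrank_zero_of_subsingleton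
    obtain ⟨⟨x, y⟩, _⟩ := this
    exact ⟨x.pos, y.pos⟩
  obtain ⟨hx2, hx3⟩ := hsize Lx hpos.1 hLx
  obtain ⟨hy2, hy3⟩ := hsize Ly hpos.2 hLy
  have hloc : IsLocal H R := isLocal_hoppingRange H
  let pc : Polynomial ℂ := p.map (algebraMap ℝ ℂ)
  have hpc : pc.natDegree + 1 ≤ n := (Nat.add_le_add_right Polynomial.natDegree_map_le 1).trans hdeg
  -- Up to a constant factor, `mc` is the minimal polynomial of `H`.
  let mc : Polynomial ℂ := (Polynomial.X - Polynomial.C (E : ℂ)) * pc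
  have hmcmap : mc = ((Polynomial.X - Polynomial.C E) * p).map (algebraMap ℝ ℂ) := by
    simp [mc, pc]
  have hmc : mc.natDegree ≤ n := by
    refine (Polynomial.natDegree_mul_le).trans ?_
    rw [Polynomial.natDegree_X_sub_C]
    omega
  have hmcH : Polynomial.aeval H mc = 0 := by
    rw [hmcmap, Polynomial.aeval_map_algebraMap]
    exact hp.aeval_mul_eq_zero
  have hP : twist (Polynomial.aeval H pc) = Polynomial.aeval (twist H) pc :=
    twist_aeval hR hloc hx2 hy2 (by omega)
  have hmc0 : Polynomial.aeval (twist H) mc = 0 := by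
    rw [← twist_aeval hR hloc hx2 hy2 hmc, hmcH, map_zero]
  have htr : (Polynomial.aeval H pc).trace = Module.finrank ℂ (energySpace H E) := by
    rw [Polynomial.aeval_map_algebraMap]
    exact hp.trace_aeval
  have htrP : (Polynomial.aeval (twist H) pc).trace = Module.finrank ℂ (energySpace H E) := by
    rw [← hP, trace_twist, htr, map_natCast]
  refine ⟨p, Polynomial.aeval (twist H) pc, ?_, htrP, fun φ => ?_⟩
  · obtain ⟨s, hs⟩ := hp.exists_sub_one_eq
    have hsq : pc * pc - pc = s.map (algebraMap ℝ ℂ) * mc := by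
      rw [hmcmap, ← Polynomial.map_mul, ← Polynomial.map_mul, ← Polynomial.map_sub]
      congr 1
      linear_combination p * hs
    have := congrArg (Polynomial.aeval (twist H)) hsq
    rwa [map_sub, map_mul, map_mul, hmc0, mul_zero, sub_eq_zero] at this
  · have htw : twisted Φ₀ H φ = (twist H).map (fluxEval Φ₀ φ) := twisted_eq_map_twist Φ₀ hx3 hy3 φ
    have hmap : Polynomial.aeval (twisted Φ₀ H φ) p
        = (Polynomial.aeval (twist H) pc).map (fluxEval Φ₀ φ) := by
      rw [map_aeval_fluxEval, ← htw, Polynomial.aeval_map_algebraMap]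
    have hlevel : IsLevelPoly (twisted Φ₀ H φ) E p := by
      refine ⟨htw ▸ fluxEval_twist_isHermitian Φ₀ φ hH, hp.eval_eq_one, ?_⟩
      rw [← Polynomial.aeval_map_algebraMap ℂ, ← hmcmap, htw, ← map_aeval_fluxEval, hmc0]
      ext
      simp
    refine ⟨hlevel, hmap, ?_⟩
    have h := hlevel.trace_aeval
    rw [hmap] at h
    have h' : ((Polynomial.aeval (twist H) pc).map (fluxEval Φ₀ φ)).trace
        = fluxEval Φ₀ φ (Polynomial.aeval (twist H) pc).trace := by
      simp only [Matrix.trace, Matrix.diag, map_sum, Matrix.map_apply]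
    rw [h', htrP, map_natCast] at h
    exact_mod_cast h.symm

end

end FlatHamiltonian

/-- `H` is a Hermitian tight-binding Hamiltonian on a torus of `Lx × Ly` cells with `N` orbitals per
cell. If `Lx` and `Ly` are at least `3 n R`, where `n` is its number of distinct energies and `R` its
maximum hopping range, then every energy has a well-defined many-body Chern number, equal to `0`. -/
theorem mainTheorem1 (Lx Ly N : ℕ) (Φ₀ : ℝ) (hΦ₀ : 0 < Φ₀)
    (H : Matrix (FlatHamiltonian.Orbital Lx Ly N) (FlatHamiltonian.Orbital Lx Ly N) ℂ)
    (hH : H.IsHermitian)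
    (hLx : 3 * ((spectrum ℝ H).ncard : ℝ) * FlatHamiltonian.hoppingRange H ≤ (Lx : ℝ))
    (hLy : 3 * ((spectrum ℝ H).ncard : ℝ) * FlatHamiltonian.hoppingRange H ≤ (Ly : ℝ)) :
    ∀ E ∈ spectrum ℝ H, FlatHamiltonian.HasManyBodyChernNumber Φ₀ H E 0 := by
  open FlatHamiltonian in
  intro E hE
  obtain ⟨p, P, hPP, htr, hφ⟩ := exists_twisted_projector hH hE hLx hLy Φ₀
  set k := Module.finrank ℂ (energySpace H E)
  have hk : 0 < k := finrank_energySpace_pos hH hE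
  have hQ : ∀ φ, ∀ Ψ ∈ filledStates (twisted Φ₀ H φ) E k,
      (slaterProj k P).map (fluxEval Φ₀ φ) = Matrix.vecMulVec Ψ.ofLp (star Ψ.ofLp) ∧
        star Ψ.ofLp ⬝ᵥ Ψ.ofLp = 1 := by
    intro φ Ψ hΨ
    rw [slaterProj_map, ← (hφ φ).2.1]
    exact (hφ φ).1.slaterProj_eq hΨ
  refine ⟨_, isBerryCurvature_of_projector (Φ₀ := Φ₀)
    (fun φ => filledStates_nonempty (hφ φ).2.2)
    (fun φ Ψ hΨ z hz => smul_mem_filledStates hk hΨ hz)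
    (fun φ Ψ hΨ => (hQ φ Ψ hΨ).1) (fun φ Ψ hΨ => (hQ φ Ψ hΨ).2), ?_, ?_⟩
  · exact ((integrableOn_fluxEval Φ₀ _).const_mul _).const_mul _
  · rw [MeasureTheory.integral_const_mul, MeasureTheory.integral_const_mul,
      setIntegral_fluxEval hΦ₀, coeff_zero_fluxCurvature_slaterProj _ _ hPP htr]
    simp
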